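/- Let $G=(V,E)$ be a finite, connected, undirected simple graph and let $N\ge 1$. For $\beta\ge 0$ let $\mu_{G,N,\beta}$ be the spin $O(N)$ model on $G$, i.e. the probability measure on $(\mathbb{S}^{N-1})^V$ with $$d\mu_{G,N,\beta}(\sigma)=\frac{1}{Z_{G,N,\beta}}\exp\Big(\beta\sum_{\{i,j\}\in E}\sigma_i\cdot\sigma_j\Big)\,d\sigma,$$ where $\mathbb{S}^{N-1}$ is the unit sphere of $\mathbb{R}^N$, $d\sigma$ is the product over $V$ of the surface measure on $\mathbb{S}^{N-1}$ (a multiple of the counting measure on $\{-1,1\}$ if $N=1$) and $Z_{G,N,\beta}$ is the normalizing constant. Let $(X_k)_{k\ge 0}$ be simple random walk on $G$, let $\mathbb{E}_s$ denote expectation for the walk started at $s$, let $H_j=\inf\{k\ge 0: X_k=j\}$, let $d(i)$ be the degree of $i$, and set $$u_{ij}(s)=\mathbb{E}_s\sum_{k=0}^{H_j-1}\mathbf{1}_{X_k=i}.$$ Then for all $x,y\in V$ the quantity $u_{xy}(x)$ is finite and $$\lim_{\beta\to\infty}\beta\cdot\mathbb{E}_{\mu_{G,N,\beta}}\lVert\sigma_x-\sigma_y\rVert^2=(N-1)\,\frac{u_{xy}(x)}{d(x)}.$$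 (For $x=y$ the sum defining $u_{xx}(x)$ is empty, and the right-hand side is read as $0$.) -/

import Mathlib

open MeasureTheory ProbabilityTheory Filter Topology
open scoped ENNReal

noncomputable section

namespace SpinON

/-- The unit sphere `S^{N-1}` of `ℝ^N` (Euclidean norm). -/
abbrev Sphere (N : ℕ) : Type :=
  Metric.sphere (0 : EuclideanSpace ℝ (Fin N)) 1

/-- The surface measure on `S^{N-1}` induced by Lebesgue measure on `ℝ^N`
(for `N = 1` it is the counting measure on the two points of `S^0`). -/
def sphereMeasure (N : ℕ) : Measure (Sphere N) :=
  (volume : Measure (EuclideanSpace ℝ (Fin N))).toSphere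

section Model

variable {V : Type*} [Fintype V] [DecidableEq V]

/-- The Hamiltonian `H(σ) = - ∑_{{i,j} ∈ E} σ_i · σ_j`; each undirected edge counts once. -/
def hamiltonian (G : SimpleGraph V) [DecidableRel G.Adj] (N : ℕ) (σ : V → Sphere N) : ℝ :=
  -∑ e ∈ G.edgeFinset,
    Sym2.lift ⟨fun i j => inner ℝ (σ i : EuclideanSpace ℝ (Fin N)) (σ j),
      fun _ _ => real_inner_comm _ _⟩ e

/-- The partition function `Z = ∫ exp(-β H(σ)) dσ` over the product of the sphere measures. -/
def partitionFunction (G : SimpleGraph V) [DecidableRel G.Adj] (N : ℕ) (β : ℝ) : ℝ :=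
  ∫ σ, Real.exp (-β * hamiltonian G N σ) ∂(Measure.pi fun _ : V => sphereMeasure N)

/-- The spin `O(N)` model on `G` at inverse temperature `β`: the measure
`dμ(σ) = Z⁻¹ exp(-β H(σ)) dσ` on `(S^{N-1})^V`. -/
def spinMeasure (G : SimpleGraph V) [DecidableRel G.Adj] (N : ℕ) (β : ℝ) :
    Measure (V → Sphere N) :=
  (Measure.pi fun _ : V => sphereMeasure N).withDensity fun σ =>
    ENNReal.ofReal (Real.exp (-β * hamiltonian G N σ) / partitionFunction G N β)

end Model

section Walk

variable {V : Type*} [Fintype V] [MeasurableSpace V] [DiscreteMeasurableSpace V]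

/-- One step of simple random walk from `v`: a uniformly chosen neighbour of `v`
(the walk stays put at a vertex without neighbours). -/
def stepPMF (G : SimpleGraph V) [DecidableRel G.Adj] (v : V) : PMF V :=
  if h : (G.neighborFinset v).Nonempty then PMF.uniformOfFinset (G.neighborFinset v) h
  else PMF.pure v

/-- The transition kernel of simple random walk: given the path up to time `n`, the next
position is a step from the position at time `n`. -/
def stepKernel (G : SimpleGraph V) [DecidableRel G.Adj] (n : ℕ) :
    Kernel (Finset.Iic n → V) V :=
  Kernel.ofFunOfCountable fun p => (stepPMF G (p ⟨n, Finset.mem_Iic.2 le_rfl⟩)).toMeasure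

instance (G : SimpleGraph V) [DecidableRel G.Adj] (n : ℕ) : IsMarkovKernel (stepKernel G n) :=
  ⟨fun p => PMF.toMeasure.isProbabilityMeasure (stepPMF G (p ⟨n, Finset.mem_Iic.2 le_rfl⟩))⟩

/-- The law `ℙ_s`, on trajectories `ℕ → V`, of simple random walk on `G` started at `s`. -/
def walkLaw (G : SimpleGraph V) [DecidableRel G.Adj] (s : V) : Measure (ℕ → V) :=
  Kernel.traj (X := fun _ : ℕ => V) (fun n => stepKernel G n) 0 (fun _ => s)

/-- The first hitting time `H_j = inf {k ≥ 0 : X_k = j}` (`⊤` if `j` is never hit). -/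
def hitTime (j : V) (ω : ℕ → V) : WithTop ℕ :=
  hittingAfter (fun (k : ℕ) (w : ℕ → V) => w k) {j} 0 ω

open Classical in
/-- The Green's function `u_{ij}(s) = 𝔼_s ∑_{k=0}^{H_j - 1} 1_{X_k = i}`, with values in
`[0, ∞]`: the expected number of visits to `i`, starting at `s`, strictly before hitting `j`. -/
def green (G : SimpleGraph V) [DecidableRel G.Adj] (i j s : V) : ℝ≥0∞ :=
  ∫⁻ ω, ∑' k : ℕ, (if (k : WithTop ℕ) < hitTime j ω ∧ ω k = i then 1 else 0) ∂(walkLaw G s)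

end Walk

end SpinON

end

/-! Write `d_ij = 1 - σ_i · σ_j`, so that `‖σ_i - σ_j‖² = 2 d_ij`, and `g_ij = β 𝔼 d_ij`. The point
is that `g` nearly solves the linear equations that characterise effective resistance.

Rotating the single spin at `i` preserves the product measure. Differentiating this invariance and
summing over all coordinate planes gives an exact Schwinger–Dyson equation (`schwinger_dyson`). In
terms of `g` it reads `∑_{j ~ i} (g_ij + g_ik - g_jk) = (N-1) 1_{i ≠ k} + error`, where the error
contains only `β 𝔼[d_ij d_ik]` and `𝔼 d_ik` (`sum_scaledDisagreement`). Subtracting the equations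
for `k = x` and `k = y` shows that `i ↦ g_iy - g_ix` has Laplacian `(N-1)(1_x - 1_y)` up to error.
On the walk side, reversibility turns the last-step equation for the Green's function into the
statement that `u_{vy}(x)/d(v)` is the voltage with Laplacian exactly `1_x - 1_y`
(`laplacian_voltage`). Pairing the two by Green's identity gives `2 g_xy = (N-1) u_{xy}(x)/d(x) +
error` (`two_mul_eq_voltage_add_error`).

The error is controlled by concentration on ground states: on a connected graph these are constant
configurations, so by compactness a disagreement above `ε` costs a fixed energy and is exponentially
unlikely. Hence the error is at most `ε (S + 1)` for large `β`, where `S` is the sum of all `g_ij`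
(`eventually_abs_sdError_le`). One small choice of `ε` bounds `S`; then `ε → 0` gives the limit. -/

namespace SpinON

/-! ### Simple random walk: the Green's function and its voltage equation. -/

section Walk

variable {V : Type*} [Fintype V]

lemma stepPMF_apply_of_adj (G : SimpleGraph V) [DecidableRel G.Adj] {v w : V} (h : G.Adj v w) :
    stepPMF G v w = (G.degree v : ℝ≥0∞)⁻¹ := by
  have hw : w ∈ G.neighborFinset v := by simpa using h
  have hne : (G.neighborFinset v).Nonempty := ⟨w, hw⟩
  rw [stepPMF, dif_pos hne, PMF.uniformOfFinset_apply_of_mem _ hw,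
    SimpleGraph.card_neighborFinset_eq_degree]

lemma stepPMF_apply_of_not_adj (G : SimpleGraph V) [DecidableRel G.Adj] {v w : V}
    (hv : 0 < G.degree v) (h : ¬ G.Adj v w) : stepPMF G v w = 0 := by
  have hw : w ∉ G.neighborFinset v := by simpa using h
  have hne : (G.neighborFinset v).Nonempty := by
    rwa [← Finset.card_pos, SimpleGraph.card_neighborFinset_eq_degree]
  rw [stepPMF, dif_pos hne, PMF.uniformOfFinset_apply_of_notMem _ hw]

omit [Fintype V] in
lemma coe_lt_hitTime_iff (j : V) (ω : ℕ → V) (k : ℕ) :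
    (k : WithTop ℕ) < hitTime j ω ↔ ∀ m ≤ k, ω m ≠ j := by
  rw [← not_le]
  refine (not_congr (hittingAfter_le_iff (i := k))).trans ?_
  simp

variable [MeasurableSpace V] [DiscreteMeasurableSpace V]

/-- The probability that the walk started at `x` is at `v` at time `n` without having visited `y`
up to that time. -/
noncomputable def survival (G : SimpleGraph V) [DecidableRel G.Adj] (x y : V) (n : ℕ) (v : V) :
    ℝ≥0∞ :=
  walkLaw G x {ω | (∀ m ≤ n, ω m ≠ y) ∧ ω n = v}

lemma measurableSet_survival (y : V) (n : ℕ) (v : V) :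
    MeasurableSet {ω : ℕ → V | (∀ m ≤ n, ω m ≠ y) ∧ ω n = v} := by
  have h (m : ℕ) (u : V) : MeasurableSet {ω : ℕ → V | ω m = u} :=
    measurableSet_eq_fun (measurable_pi_apply m) measurable_const
  have : {ω : ℕ → V | (∀ m ≤ n, ω m ≠ y) ∧ ω n = v} =
      (⋂ m, ⋂ (_ : m ≤ n), {ω | ω m = y}ᶜ) ∩ {ω | ω n = v} := by
    ext ω; simp
  rw [this]
  refine MeasurableSet.inter ?_ (h n v)
  exact MeasurableSet.iInter fun m => MeasurableSet.iInter fun _ => (h m y).compl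

lemma green_eq_tsum_survival (G : SimpleGraph V) [DecidableRel G.Adj] (x y v : V) :
    green G v y x = ∑' n, survival G x y n v := by
  classical
  have key (k : ℕ) : (fun ω : ℕ → V =>
      (if (k : WithTop ℕ) < hitTime y ω ∧ ω k = v then 1 else 0 : ℝ≥0∞)) =
      Set.indicator {ω : ℕ → V | (∀ m ≤ k, ω m ≠ y) ∧ ω k = v} 1 := by
    funext ω
    simp only [coe_lt_hitTime_iff, Set.indicator_apply, Set.mem_ofPred_eq, Pi.one_apply]
  rw [green, lintegral_tsum]
  · refine tsum_congr fun k => ?_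
    have := congrArg (fun f => ∫⁻ ω, f ω ∂(walkLaw G x)) (key k)
    simp only at this
    rw [lintegral_indicator_one (measurableSet_survival y k v)] at this
    rw [survival, ← this]
  · intro k
    have h := (measurable_one : Measurable (1 : (ℕ → V) → ℝ≥0∞)).indicator
      (measurableSet_survival y k v)
    rw [← key k] at h
    exact h.aemeasurable

lemma survival_self_right (G : SimpleGraph V) [DecidableRel G.Adj] (x y : V) (n : ℕ) :
    survival G x y n y = 0 := by
  rw [survival]
  convert measure_empty (μ := walkLaw G x)
  ext ω
  simp only [Set.mem_ofPred_eq, Set.mem_empty_iff_false, iff_false, not_and]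
  exact fun h => h n le_rfl

lemma survival_zero (G : SimpleGraph V) [DecidableRel G.Adj] [DecidableEq V] {x y : V}
    (v : V) : survival G x y 0 v = if x ≠ y ∧ v = x then 1 else 0 := by
  have hs : MeasurableSet {p : Finset.Iic 0 → V |
      p ⟨0, by simp⟩ ≠ y ∧ p ⟨0, by simp⟩ = v} := MeasurableSet.of_discrete
  have hset : {ω : ℕ → V | (∀ m ≤ 0, ω m ≠ y) ∧ ω 0 = v} =
      (Preorder.frestrictLe (π := fun _ => V) 0) ⁻¹'
        {p : Finset.Iic 0 → V | p ⟨0, by simp⟩ ≠ y ∧ p ⟨0, by simp⟩ = v} := by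
    ext ω
    simp [Preorder.frestrictLe]
  rw [survival, hset, ← Measure.map_apply (Preorder.measurable_frestrictLe 0) hs, walkLaw,
    Kernel.traj_map_frestrictLe_apply, Kernel.partialTraj_self, Kernel.id_apply,
    Measure.dirac_apply' _ hs]
  simp only [Set.indicator_apply, Set.mem_ofPred_eq, Pi.one_apply]
  congr 1
  rw [eq_comm (a := v)]

/-- Markov property at time `n`, after splitting by the position there. Since `v ≠ y`, ending at `v`
already avoids `y` at time `n + 1`. -/
lemma survival_succ (G : SimpleGraph V) [DecidableRel G.Adj] {x y v : V} (hv : v ≠ y) (n : ℕ) :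
    survival G x y (n + 1) v = ∑ w, survival G x y n w * stepPMF G w v := by
  classical
  set S : V → Set (Finset.Iic n → V) := fun w =>
    {p | (∀ m (h : m ≤ n), p ⟨m, Finset.mem_Iic.2 h⟩ ≠ y) ∧
      p ⟨n, Finset.mem_Iic.2 le_rfl⟩ = w} with hS
  have hSm (w : V) : MeasurableSet (S w) := MeasurableSet.of_discrete
  have hpre (w : V) : {ω : ℕ → V | (∀ m ≤ n, ω m ≠ y) ∧ ω n = w} =
      (Preorder.frestrictLe (π := fun _ => V) n) ⁻¹' S w := by
    ext ω
    simp [Preorder.frestrictLe, hS]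
  have hsplit : {ω : ℕ → V | (∀ m ≤ n + 1, ω m ≠ y) ∧ ω (n + 1) = v} =
      ⋃ w, (fun ω : ℕ → V => (Preorder.frestrictLe (π := fun _ => V) n ω, ω (n + 1))) ⁻¹'
        (S w ×ˢ {v}) := by
    ext ω
    simp only [Set.mem_ofPred_eq, hS, Set.mem_iUnion, Set.mem_preimage, Set.mem_prod,
      Set.mem_singleton_iff, Preorder.frestrictLe_apply]
    constructor
    · rintro ⟨h1, h2⟩
      exact ⟨ω n, ⟨fun m hm => h1 m (by omega), rfl⟩, h2⟩
    · rintro ⟨w, ⟨h1, -⟩, h2⟩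
      refine ⟨fun m hm => ?_, h2⟩
      rcases Nat.le_succ_iff.1 hm with h | h
      · exact h1 m h
      · rw [h, h2]; exact hv
  have hmeas : Measurable
      (fun ω : ℕ → V => (Preorder.frestrictLe (π := fun _ => V) n ω, ω (n + 1))) := by
    fun_prop
  rw [survival, hsplit, measure_iUnion, tsum_fintype]
  · refine Finset.sum_congr rfl fun w _ => ?_
    rw [← Measure.map_apply hmeas ((hSm w).prod (MeasurableSet.singleton v)), walkLaw,
      ← Kernel.partialTraj_compProd_eq_map_traj (Nat.zero_le n),
      Measure.compProd_apply_prod (hSm w) (MeasurableSet.singleton v)]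
    have : ∀ p ∈ S w, stepKernel G n p {v} = stepPMF G w v := by
      rintro p ⟨-, hp⟩
      change (stepPMF G (p ⟨n, _⟩)).toMeasure {v} = _
      rw [hp, PMF.toMeasure_apply_singleton _ _ (MeasurableSet.singleton v)]
    rw [setLIntegral_congr_fun (hSm w) this, setLIntegral_const, mul_comm, survival, hpre w,
      ← Kernel.traj_map_frestrictLe_apply,
      Measure.map_apply (Preorder.measurable_frestrictLe n) (hSm w)]
    rfl
  · intro a b hab
    refine Set.disjoint_left.2 fun ω h1 h2 => hab ?_
    exact h1.1.2.symm.trans h2.1.2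
  · exact fun w => hmeas ((hSm w).prod (MeasurableSet.singleton v))

omit [MeasurableSpace V] [DiscreteMeasurableSpace V] in
lemma sum_stepPMF (G : SimpleGraph V) [DecidableRel G.Adj] (w : V) :
    ∑ v, stepPMF G w v = 1 := by
  rw [← tsum_fintype (L := SummationFilter.unconditional V)]
  exact (stepPMF G w).tsum_coe

lemma sum_survival_eq (G : SimpleGraph V) [DecidableRel G.Adj] (x y : V) (n : ℕ) :
    ∑ v, survival G x y n v =
      ∑ v, survival G x y (n + 1) v + ∑ w, survival G x y n w * stepPMF G w y := by
  classical
  have h1 : ∑ v, survival G x y n v = ∑ v, ∑ w, survival G x y n w * stepPMF G w v := by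
    rw [Finset.sum_comm]
    refine Finset.sum_congr rfl fun w _ => ?_
    rw [← Finset.mul_sum, sum_stepPMF, mul_one]
  rw [h1, ← Finset.add_sum_erase _ _ (Finset.mem_univ y),
    ← Finset.add_sum_erase _ (survival G x y (n + 1)) (Finset.mem_univ y),
    survival_self_right, zero_add, add_comm]
  congr 1
  refine Finset.sum_congr rfl fun v hv => ?_
  rw [survival_succ G (Finset.ne_of_mem_erase hv)]

/-- Absorbed plus surviving mass is conserved by `sum_survival_eq`; its initial value is `1`, or `0`
when `x = y`. -/
lemma sum_range_absorption_le (G : SimpleGraph V) [DecidableRel G.Adj] (x y : V) (n : ℕ) :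
    ∑ k ∈ Finset.range n, ∑ w, survival G x y k w * stepPMF G w y +
      ∑ v, survival G x y n v ≤ 1 := by
  classical
  induction n with
  | zero =>
    simp only [Finset.range_zero, Finset.sum_empty, zero_add, survival_zero]
    rw [Finset.sum_eq_single x (by aesop) (by simp)]
    split_ifs <;> simp
  | succ n ih =>
    rw [sum_survival_eq] at ih
    rw [Finset.sum_range_succ, add_assoc]
    rwa [add_comm (∑ v, survival G x y (n + 1) v)] at ih

/-- The product is the total mass absorbed at `y` by a step from `w`. This starts the finiteness
induction at the neighbours of `y`. -/
lemma green_mul_stepPMF_le_one (G : SimpleGraph V) [DecidableRel G.Adj] (x y w : V) :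
    green G w y x * stepPMF G w y ≤ 1 := by
  rw [green_eq_tsum_survival, ← ENNReal.tsum_mul_right]
  refine ENNReal.tsum_le_of_sum_range_le fun n => ?_
  refine le_trans ?_ ((self_le_add_right _ _).trans (sum_range_absorption_le G x y n))
  exact Finset.sum_le_sum fun k _ =>
    Finset.single_le_sum (f := fun w => survival G x y k w * stepPMF G w y)
      (fun _ _ => zero_le) (Finset.mem_univ w)

lemma green_self_right (G : SimpleGraph V) [DecidableRel G.Adj] (x y : V) :
    green G y y x = 0 := by
  simp [green_eq_tsum_survival, survival_self_right]

/-- Each visit to `v` is either the start or is reached by a last step from some `w`. -/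
lemma green_eq_add_sum (G : SimpleGraph V) [DecidableRel G.Adj] [DecidableEq V] {x y v : V}
    (hxy : x ≠ y) (hv : v ≠ y) :
    green G v y x = (if v = x then 1 else 0) + ∑ w, green G w y x * stepPMF G w v := by
  simp_rw [green_eq_tsum_survival, ← ENNReal.tsum_mul_right]
  rw [tsum_eq_zero_add' (f := fun n => survival G x y n v) ENNReal.summable, survival_zero]
  simp only [hxy, ne_eq, not_false_eq_true, true_and]
  congr 1
  simp_rw [survival_succ G hv]
  rw [Summable.tsum_finsetSum fun _ _ => ENNReal.summable]

/-- Finiteness spreads from `y` along edges: visits to `w` feed its neighbour `v` with positive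
probability, so infinitely many expected visits to `w` would force the same at `v`, or an infinite
absorbed mass if `v = y`. -/
lemma green_ne_top (G : SimpleGraph V) [DecidableRel G.Adj] (hG : G.Connected) (x y w : V) :
    green G w y x ≠ ∞ := by
  classical
  by_cases hxy : x = y
  · subst hxy
    have h0 (n : ℕ) : survival G x x n w = 0 := by
      rw [survival]
      refine measure_mono_null (t := {ω | (∀ m ≤ 0, ω m ≠ x) ∧ ω 0 ∈ Set.univ}) ?_ ?_
      · rintro ω ⟨h, -⟩
        exact ⟨fun m hm => h m (by omega), trivial⟩
      · have : {ω : ℕ → V | (∀ m ≤ 0, ω m ≠ x) ∧ ω 0 ∈ Set.univ} =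
            ⋃ v, {ω | (∀ m ≤ 0, ω m ≠ x) ∧ ω 0 = v} := by
          ext ω; simp
        rw [this, measure_iUnion_null_iff]
        intro v
        have := survival_zero G (x := x) (y := x) v
        simpa [survival] using this
    simp [green_eq_tsum_survival, h0]
  · have hr := (SimpleGraph.reachable_iff_reflTransGen y w).1 (hG.preconnected y w)
    induction hr with
    | refl => simp [green_self_right]
    | @tail v w _ hvw ih =>
      have hstep : green G w y x * stepPMF G w v ≠ ∞ := by
        by_cases hv : v = y
        · subst hv
          exact ne_top_of_le_ne_top ENNReal.one_ne_top (green_mul_stepPMF_le_one G x v w)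
        · refine ne_top_of_le_ne_top ih ?_
          rw [green_eq_add_sum G hxy hv]
          refine le_trans ?_ le_add_self
          exact Finset.single_le_sum (f := fun w => green G w y x * stepPMF G w v)
            (fun _ _ => zero_le) (Finset.mem_univ w)
      intro htop
      rw [htop, stepPMF_apply_of_adj G hvw.symm, ENNReal.top_mul] at hstep
      · exact hstep rfl
      · simp

/-- The voltage at `v` when a unit current flows from `x` to the grounded vertex `y`. -/
noncomputable def voltage (G : SimpleGraph V) [DecidableRel G.Adj] (x y v : V) : ℝ :=
  (green G v y x).toReal / G.degree v

lemma voltage_self_right (G : SimpleGraph V) [DecidableRel G.Adj] (x y : V) :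
    voltage G x y y = 0 := by
  simp [voltage, green_self_right]

omit [MeasurableSpace V] [DiscreteMeasurableSpace V] in
lemma sum_sum_neighborFinset_sub (G : SimpleGraph V) [DecidableRel G.Adj] (f : V → ℝ) :
    ∑ v, ∑ w ∈ G.neighborFinset v, (f v - f w) = 0 := by
  have h (g : V → V → ℝ) : ∑ v, ∑ w ∈ G.neighborFinset v, g v w =
      ∑ v, ∑ w ∈ G.neighborFinset v, g w v := by
    refine Finset.sum_comm' fun v w => ?_
    simp [SimpleGraph.adj_comm]
  simp_rw [Finset.sum_sub_distrib]
  rw [h fun _ w => f w, sub_self]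

/-- Dividing by the degree cancels the factor `1 / d(w)` in the step probability, so the last-step
equation becomes Kirchhoff's law. -/
lemma laplacian_voltage_of_ne (G : SimpleGraph V) [DecidableRel G.Adj] [DecidableEq V]
    (hG : G.Connected) {x y v : V} (hxy : x ≠ y) (hv : v ≠ y) :
    ∑ w ∈ G.neighborFinset v, (voltage G x y v - voltage G x y w) = if v = x then 1 else 0 := by
  have : Nontrivial V := ⟨x, y, hxy⟩
  have hdeg (u : V) : 0 < G.degree u := hG.preconnected.degree_pos_of_nontrivial u
  have h := congrArg ENNReal.toReal (green_eq_add_sum G hxy hv)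
  have hfin (w : V) : green G w y x * stepPMF G w v ≠ ∞ :=
    ENNReal.mul_ne_top (green_ne_top G hG x y w) ((stepPMF G w).apply_ne_top v)
  rw [ENNReal.toReal_add (by split_ifs <;> simp) (ENNReal.sum_ne_top.2 fun w _ => hfin w),
    ENNReal.toReal_sum fun w _ => hfin w] at h
  have hterm : ∑ w, (green G w y x * stepPMF G w v).toReal =
      ∑ w ∈ G.neighborFinset v, voltage G x y w := by
    rw [← Finset.sum_subset (Finset.subset_univ (G.neighborFinset v))]
    · refine Finset.sum_congr rfl fun w hw => ?_
      have hvw : G.Adj v w := by simpa using hw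
      rw [stepPMF_apply_of_adj G hvw.symm, voltage]
      simp [div_eq_mul_inv]
    · intro w _ hw
      have hvw : ¬ G.Adj w v := fun h => hw (by simpa using h.symm)
      simp [stepPMF_apply_of_not_adj G (hdeg w) hvw]
  rw [hterm] at h
  rw [Finset.sum_sub_distrib, Finset.sum_const, SimpleGraph.card_neighborFinset_eq_degree,
    nsmul_eq_mul, sub_eq_iff_eq_add]
  have hd : (G.degree v : ℝ) ≠ 0 := by exact_mod_cast (hdeg v).ne'
  rw [voltage, mul_div_cancel₀ _ hd, h]
  congr 1
  split_ifs <;> simp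

/-- The last-step equation is unavailable at `y`; the value there is forced because a Laplacian sums
to zero. -/
lemma laplacian_voltage (G : SimpleGraph V) [DecidableRel G.Adj] [DecidableEq V]
    (hG : G.Connected) {x y : V} (hxy : x ≠ y) (v : V) :
    ∑ w ∈ G.neighborFinset v, (voltage G x y v - voltage G x y w) =
      (if v = x then 1 else 0) - (if v = y then 1 else 0) := by
  by_cases hv : v = y
  · subst hv
    have h := sum_sum_neighborFinset_sub G (voltage G x v)
    rw [← Finset.add_sum_erase _ _ (Finset.mem_univ v),
      Finset.sum_congr rfl fun u hu =>
        laplacian_voltage_of_ne G hG hxy (Finset.ne_of_mem_erase hu)] at h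
    rw [Finset.sum_ite_eq', if_pos (by simp [hxy])] at h
    rw [if_neg (Ne.symm hxy), if_pos rfl]
    linarith
  · rw [laplacian_voltage_of_ne G hG hxy hv, if_neg hv, sub_zero]

end Walk

/-! ### Rotations of the sphere and their generators. -/

section Rotation

variable {N : ℕ}

/-- The action of a linear isometry on the unit sphere. -/
noncomputable def rotateSphere (L : EuclideanSpace ℝ (Fin N) ≃ₗᵢ[ℝ] EuclideanSpace ℝ (Fin N))
    (s : Sphere N) : Sphere N :=
  ⟨L s, by simp⟩

@[simp] lemma coe_rotateSphere (L : EuclideanSpace ℝ (Fin N) ≃ₗᵢ[ℝ] EuclideanSpace ℝ (Fin N))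
    (s : Sphere N) : (rotateSphere L s : EuclideanSpace ℝ (Fin N)) = L s := rfl

lemma continuous_rotateSphere
    (L : EuclideanSpace ℝ (Fin N) ≃ₗᵢ[ℝ] EuclideanSpace ℝ (Fin N)) :
    Continuous (rotateSphere L) :=
  (L.continuous.comp continuous_subtype_val).subtype_mk _

open scoped Pointwise in
-- Surface measure is a multiple of the Lebesgue measure of the cone over a set, and linear
-- isometries commute with taking cones.
lemma measurePreserving_rotateSphere
    (L : EuclideanSpace ℝ (Fin N) ≃ₗᵢ[ℝ] EuclideanSpace ℝ (Fin N)) :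
    MeasurePreserving (rotateSphere L) (sphereMeasure N) (sphereMeasure N) := by
  refine ⟨(continuous_rotateSphere L).measurable, Measure.ext fun s hs => ?_⟩
  have hs' := (continuous_rotateSphere L).measurable hs
  rw [Measure.map_apply (continuous_rotateSphere L).measurable hs, sphereMeasure,
    Measure.toSphere_apply' _ hs, Measure.toSphere_apply' _ hs']
  congr 1
  rw [← L.measurePreserving.measure_preimage_equiv (f := L.toMeasurableEquiv)
    (Set.Ioo (0 : ℝ) 1 • (Subtype.val '' s))]
  congr 1
  ext z
  simp only [Set.mem_smul, Set.mem_image, Set.mem_preimage]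
  constructor
  · rintro ⟨r, hr, _, ⟨u, hu, rfl⟩, rfl⟩
    exact ⟨r, hr, _, ⟨rotateSphere L u, hu, rfl⟩, by simp⟩
  · rintro ⟨r, hr, _, ⟨u, hu, rfl⟩, h⟩
    have hL : rotateSphere L (rotateSphere L.symm u) = u := Subtype.ext (by simp)
    refine ⟨r, hr, _, ⟨rotateSphere L.symm u, by rwa [hL], rfl⟩, ?_⟩
    apply L.injective
    rw [map_smul]
    exact (congrArg (fun v : Sphere N => r • (v : EuclideanSpace ℝ (Fin N))) hL).trans h

/-- The infinitesimal rotation in the coordinate plane spanned by the basis vectors `a`, `b`. -/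
noncomputable def planeRotation (a b : Fin N) :
    EuclideanSpace ℝ (Fin N) →L[ℝ] EuclideanSpace ℝ (Fin N) :=
  (EuclideanSpace.proj a : EuclideanSpace ℝ (Fin N) →L[ℝ] ℝ).smulRight
      (EuclideanSpace.single b (1 : ℝ)) -
    (EuclideanSpace.proj b : EuclideanSpace ℝ (Fin N) →L[ℝ] ℝ).smulRight
      (EuclideanSpace.single a (1 : ℝ))

lemma planeRotation_apply (a b : Fin N) (u : EuclideanSpace ℝ (Fin N)) :
    planeRotation a b u =
      u a • EuclideanSpace.single b (1 : ℝ) - u b • EuclideanSpace.single a (1 : ℝ) := rfl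

lemma inner_planeRotation_left (a b : Fin N) (u v : EuclideanSpace ℝ (Fin N)) :
    inner ℝ (planeRotation a b u) v = u a * v b - u b * v a := by
  simp [planeRotation_apply, inner_sub_left, inner_smul_left, EuclideanSpace.inner_single_left]

lemma inner_planeRotation_comm (a b : Fin N) (u v : EuclideanSpace ℝ (Fin N)) :
    inner ℝ (planeRotation a b u) v = -inner ℝ u (planeRotation a b v) := by
  rw [real_inner_comm (planeRotation a b v) u, inner_planeRotation_left,
    inner_planeRotation_left]
  ring

lemma planeRotation_mem_skewAdjoint (a b : Fin N) :
    planeRotation a b ∈ skewAdjoint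
      (EuclideanSpace ℝ (Fin N) →L[ℝ] EuclideanSpace ℝ (Fin N)) := by
  rw [skewAdjoint.mem_iff, ContinuousLinearMap.star_eq_adjoint]
  symm
  rw [ContinuousLinearMap.eq_adjoint_iff]
  intro u v
  rw [neg_apply, inner_neg_left, inner_planeRotation_comm, neg_neg]

lemma inner_euclidean_eq_sum (u v : EuclideanSpace ℝ (Fin N)) :
    inner ℝ u v = ∑ c, u c * v c := by
  rw [PiLp.inner_apply]
  exact Finset.sum_congr rfl fun c _ => by simp [mul_comm]

/-- Lagrange's identity. Ordered pairs count each plane twice, hence the factor `2`. -/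
lemma sum_inner_planeRotation_mul (u v w : EuclideanSpace ℝ (Fin N)) :
    ∑ a, ∑ b, inner ℝ (planeRotation a b u) v * inner ℝ (planeRotation a b u) w =
      2 * (inner ℝ u u * inner ℝ v w - inner ℝ u v * inner ℝ u w) := by
  simp_rw [inner_planeRotation_left, inner_euclidean_eq_sum, Finset.sum_mul_sum]
  have h1 : ∑ a, ∑ b, (u a * v b - u b * v a) * (u a * w b - u b * w a) =
      (∑ a, ∑ b, u a * u a * (v b * w b) + ∑ a, ∑ b, u b * u b * (v a * w a)) -
      (∑ a, ∑ b, u a * v a * (u b * w b) + ∑ a, ∑ b, u b * v b * (u a * w a)) := by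
    simp_rw [← Finset.sum_add_distrib, ← Finset.sum_sub_distrib]
    exact Finset.sum_congr rfl fun a _ => Finset.sum_congr rfl fun b _ => by ring
  rw [h1, Finset.sum_comm (f := fun a b => u b * u b * (v a * w a)),
    Finset.sum_comm (f := fun a b => u b * v b * (u a * w a))]
  ring

/-- The Casimir computation, which is the source of the factor `N - 1`: each coordinate lies in `N -
1` coordinate planes. -/
lemma sum_inner_planeRotation_planeRotation (u v : EuclideanSpace ℝ (Fin N)) :
    ∑ a, ∑ b, inner ℝ (planeRotation a b u) (planeRotation a b v) =
      2 * ((N : ℝ) - 1) * inner ℝ u v := by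
  have h (a b : Fin N) : inner ℝ (planeRotation a b u) (planeRotation a b v) =
      u a * v a + u b * v b - (if a = b then 2 * (u a * v a) else 0) := by
    rw [inner_planeRotation_left, planeRotation_apply]
    by_cases hab : a = b
    · subst hab; simp; ring
    · simp [hab, Ne.symm hab]
  simp_rw [h, Finset.sum_sub_distrib, Finset.sum_add_distrib, Finset.sum_ite_eq,
    inner_euclidean_eq_sum]
  simp [← Finset.mul_sum]
  ring

lemma exp_smul_mem_unitary
    {A : EuclideanSpace ℝ (Fin N) →L[ℝ] EuclideanSpace ℝ (Fin N)} (hA : A ∈ skewAdjoint _)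
    (t : ℝ) : NormedSpace.exp (t • A) ∈ unitary _ := by
  let _ : NormedAlgebra ℚ (EuclideanSpace ℝ (Fin N) →L[ℝ] EuclideanSpace ℝ (Fin N)) :=
    NormedAlgebra.restrictScalars ℚ ℝ _
  exact NormedSpace.exp_mem_unitary_of_mem_skewAdjoint (skewAdjoint.smul_mem t hA)

/-- The one-parameter group of rotations generated by a skew-adjoint operator. -/
noncomputable def rotationFlow
    {A : EuclideanSpace ℝ (Fin N) →L[ℝ] EuclideanSpace ℝ (Fin N)} (hA : A ∈ skewAdjoint _)
    (t : ℝ) : EuclideanSpace ℝ (Fin N) ≃ₗᵢ[ℝ] EuclideanSpace ℝ (Fin N) :=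
  Unitary.linearIsometryEquiv ⟨NormedSpace.exp (t • A), exp_smul_mem_unitary hA t⟩

lemma rotationFlow_apply
    {A : EuclideanSpace ℝ (Fin N) →L[ℝ] EuclideanSpace ℝ (Fin N)} (hA : A ∈ skewAdjoint _)
    (t : ℝ) (u : EuclideanSpace ℝ (Fin N)) :
    rotationFlow hA t u = NormedSpace.exp (t • A) u := rfl

lemma rotationFlow_zero
    {A : EuclideanSpace ℝ (Fin N) →L[ℝ] EuclideanSpace ℝ (Fin N)} (hA : A ∈ skewAdjoint _)
    (u : EuclideanSpace ℝ (Fin N)) : rotationFlow hA 0 u = u := by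
  have h : (0 : ℝ) • A = 0 := zero_smul ℝ A
  rw [rotationFlow_apply, h, NormedSpace.exp_zero]
  rfl

lemma hasDerivAt_rotationFlow
    {A : EuclideanSpace ℝ (Fin N) →L[ℝ] EuclideanSpace ℝ (Fin N)} (hA : A ∈ skewAdjoint _)
    (t : ℝ) (u : EuclideanSpace ℝ (Fin N)) :
    HasDerivAt (fun t => rotationFlow hA t u) (A (rotationFlow hA t u)) t := by
  simp_rw [rotationFlow_apply]
  exact (hasDerivAt_exp_smul_const' A t).clm_apply (hasDerivAt_const t u) |>.congr_deriv (by simp)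

end Rotation

instance (N : ℕ) : IsFiniteMeasure (sphereMeasure N) := by
  unfold sphereMeasure; infer_instance

instance (N : ℕ) : (sphereMeasure N).IsOpenPosMeasure := by
  unfold sphereMeasure; infer_instance

/-! ### Single-spin rotations and invariance of the Gibbs weight. -/

section Model

variable {V : Type*} [Fintype V] [DecidableEq V] {N : ℕ}

omit [DecidableEq V] in
lemma integrable_of_continuous {f : (V → Sphere N) → ℝ} (hf : Continuous f) :
    Integrable f (Measure.pi fun _ : V => sphereMeasure N) := by
  rw [← integrableOn_univ]
  exact hf.continuousOn.integrableOn_compact isCompact_univ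

omit [Fintype V] [DecidableEq V] in
lemma continuous_coe_apply (i : V) :
    Continuous fun σ : V → Sphere N => (σ i : EuclideanSpace ℝ (Fin N)) :=
  continuous_subtype_val.comp (continuous_apply i)

omit [DecidableEq V] in
lemma continuous_hamiltonian (G : SimpleGraph V) [DecidableRel G.Adj] :
    Continuous (hamiltonian G N) := by
  unfold hamiltonian
  refine (continuous_finsetSum _ fun e _ => ?_).neg
  induction e with
  | h i j =>
    simp only [Sym2.lift_mk]
    exact (continuous_coe_apply i).inner (continuous_coe_apply j)

/-- The field acting on the spin at `i`: the sum of the neighbouring spins. -/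
noncomputable def localField (G : SimpleGraph V) [DecidableRel G.Adj] (i : V)
    (σ : V → Sphere N) : EuclideanSpace ℝ (Fin N) :=
  ∑ j ∈ G.neighborFinset i, (σ j : EuclideanSpace ℝ (Fin N))

omit [DecidableEq V] in
lemma continuous_localField (G : SimpleGraph V) [DecidableRel G.Adj] (i : V) :
    Continuous (localField (N := N) G i) :=
  continuous_finsetSum _ fun j _ => continuous_coe_apply j

lemma localField_update (G : SimpleGraph V) [DecidableRel G.Adj] (i : V) (σ : V → Sphere N)
    (s : Sphere N) : localField G i (Function.update σ i s) = localField G i σ := by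
  refine Finset.sum_congr rfl fun j hj => ?_
  have hij : G.Adj i j := by simpa using hj
  rw [Function.update_of_ne hij.ne']

lemma sum_edgeFinset_eq_sum_neighborFinset (G : SimpleGraph V) [DecidableRel G.Adj] (i : V)
    (g : Sym2 V → ℝ) (hg : ∀ e, i ∉ e → g e = 0) :
    ∑ e ∈ G.edgeFinset, g e = ∑ j ∈ G.neighborFinset i, g s(i, j) := by
  have himage : ∑ e ∈ (G.neighborFinset i).image (fun j => s(i, j)), g e =
      ∑ j ∈ G.neighborFinset i, g s(i, j) :=
    Finset.sum_image fun a _ b _ h => Sym2.congr_right.1 h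
  rw [← himage]
  symm
  apply Finset.sum_subset
  · intro e he
    obtain ⟨j, hj, rfl⟩ := Finset.mem_image.1 he
    simpa using hj
  · intro e he hne
    refine hg e fun hi => hne ?_
    obtain ⟨j, rfl⟩ := Sym2.mem_iff_exists.1 hi
    exact Finset.mem_image.2 ⟨j, by simpa using he, rfl⟩

lemma hamiltonian_update (G : SimpleGraph V) [DecidableRel G.Adj] (i : V) (σ : V → Sphere N)
    (s : Sphere N) :
    hamiltonian G N (Function.update σ i s) = hamiltonian G N σ -
      inner ℝ ((s : EuclideanSpace ℝ (Fin N)) - σ i) (localField G i σ) := by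
  set E : (V → Sphere N) → Sym2 V → ℝ := fun σ => Sym2.lift
    ⟨fun i j => inner ℝ (σ i : EuclideanSpace ℝ (Fin N)) (σ j),
      fun _ _ => real_inner_comm _ _⟩ with hE
  have h := sum_edgeFinset_eq_sum_neighborFinset G i
    (fun e => E (Function.update σ i s) e - E σ e) (by
      intro e he
      induction e with
      | h a b =>
        simp only [Sym2.mem_iff, not_or] at he
        simp [hE, Function.update_of_ne (Ne.symm he.1), Function.update_of_ne (Ne.symm he.2)])
  have h2 : ∑ j ∈ G.neighborFinset i, (E (Function.update σ i s) s(i, j) - E σ s(i, j)) =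
      inner ℝ ((s : EuclideanSpace ℝ (Fin N)) - σ i) (localField G i σ) := by
    rw [localField, inner_sum]
    refine Finset.sum_congr rfl fun j hj => ?_
    have hij : G.Adj i j := by simpa using hj
    simp [hE, Function.update_of_ne hij.ne', inner_sub_left]
  rw [h2, Finset.sum_sub_distrib] at h
  simp only [hamiltonian]
  linarith

lemma measurePreserving_update_rotateSphere (i : V)
    (L : EuclideanSpace ℝ (Fin N) ≃ₗᵢ[ℝ] EuclideanSpace ℝ (Fin N)) :
    MeasurePreserving (fun σ : V → Sphere N => Function.update σ i (rotateSphere L (σ i)))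
      (Measure.pi fun _ : V => sphereMeasure N) (Measure.pi fun _ : V => sphereMeasure N) := by
  have h := measurePreserving_pi (fun _ : V => sphereMeasure N) (fun _ : V => sphereMeasure N)
    (f := fun j s => if j = i then rotateSphere L s else s) fun j => by
      by_cases hj : j = i
      · simpa [hj] using measurePreserving_rotateSphere L
      · simpa [hj] using! MeasurePreserving.id (sphereMeasure N)
  convert h using 2 with σ
  funext j
  by_cases hj : j = i
  · subst hj; simp
  · simp [hj]

/-- Infinitesimal invariance of the weighted measure under rotations of the spin at `i`. -/
lemma integral_skewAdjoint_eq_zero (G : SimpleGraph V) [DecidableRel G.Adj] (β : ℝ)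
    {A : EuclideanSpace ℝ (Fin N) →L[ℝ] EuclideanSpace ℝ (Fin N)} (hA : A ∈ skewAdjoint _)
    {i k : V} (hik : i ≠ k) :
    ∫ σ : V → Sphere N,
      (inner ℝ (A (A (σ i))) (σ k : EuclideanSpace ℝ (Fin N)) +
        β * (inner ℝ (A (σ i)) (σ k : EuclideanSpace ℝ (Fin N)) *
          inner ℝ (A (σ i)) (localField G i σ))) * Real.exp (-β * hamiltonian G N σ)
      ∂(Measure.pi fun _ : V => sphereMeasure N) = 0 := by
  set μ := Measure.pi fun _ : V => sphereMeasure N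
  set F : (V → Sphere N) → ℝ := fun σ =>
    inner ℝ (A (σ i)) (σ k : EuclideanSpace ℝ (Fin N)) * Real.exp (-β * hamiltonian G N σ) with hF
  set D : (V → Sphere N) → ℝ := fun σ =>
      (inner ℝ (A (A (σ i))) (σ k : EuclideanSpace ℝ (Fin N)) +
        β * (inner ℝ (A (σ i)) (σ k : EuclideanSpace ℝ (Fin N)) *
          inner ℝ (A (σ i)) (localField G i σ))) * Real.exp (-β * hamiltonian G N σ) with hD
  set T : ℝ → (V → Sphere N) → (V → Sphere N) := fun t σ =>
    Function.update σ i (rotateSphere (rotationFlow hA t) (σ i)) with hT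
  have hTc (t : ℝ) : Continuous (T t) :=
    continuous_id.update i ((continuous_rotateSphere _).comp (continuous_apply i))
  have hexp : Continuous fun σ : V → Sphere N => Real.exp (-β * hamiltonian G N σ) :=
    Real.continuous_exp.comp (continuous_const.mul (continuous_hamiltonian G))
  have hi := continuous_coe_apply (N := N) i
  have hk := continuous_coe_apply (N := N) k
  have hAi := A.continuous.comp hi
  have hAAi := A.continuous.comp hAi
  have hFc : Continuous F := (hAi.inner hk).mul hexp
  have hDc : Continuous D :=
    ((hAAi.inner hk).add (continuous_const.mul
      ((hAi.inner hk).mul (hAi.inner (continuous_localField G i))))).mul hexp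
  obtain ⟨C, hC⟩ := isCompact_univ.exists_bound_of_continuousOn hDc.continuousOn
  have hderiv (t : ℝ) (σ : V → Sphere N) : HasDerivAt (fun t => F (T t σ)) (D (T t σ)) t := by
    have hR := hasDerivAt_rotationFlow hA t (σ i : EuclideanSpace ℝ (Fin N))
    have h1 : HasDerivAt (fun t => inner ℝ (A (rotationFlow hA t (σ i)))
        (σ k : EuclideanSpace ℝ (Fin N)))
        (inner ℝ (A (A (rotationFlow hA t (σ i)))) (σ k : EuclideanSpace ℝ (Fin N))) t := by
      simpa using (A.hasFDerivAt.comp_hasDerivAt t hR).inner ℝ (hasDerivAt_const t _)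
    have h2 : HasDerivAt (fun t => inner ℝ (rotationFlow hA t (σ i) - (σ i : _))
        (localField G i σ))
        (inner ℝ (A (rotationFlow hA t (σ i))) (localField G i σ)) t := by
      simpa using (hR.sub_const _).inner ℝ (hasDerivAt_const t (localField G i σ))
    have h3 := h1.mul ((h2.const_sub (hamiltonian G N σ)).const_mul (-β)).exp
    have hval (t : ℝ) : (T t σ i : EuclideanSpace ℝ (Fin N)) = rotationFlow hA t (σ i) := by
      simp [hT]
    have hvalk (t : ℝ) : T t σ k = σ k := by simp [hT, hik.symm]
    have hham (t : ℝ) : hamiltonian G N (T t σ) = hamiltonian G N σ -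
        inner ℝ (rotationFlow hA t (σ i) - (σ i : EuclideanSpace ℝ (Fin N)))
          (localField G i σ) := by
      simp [hT, hamiltonian_update]
    have hloc (t : ℝ) : localField G i (T t σ) = localField G i σ := localField_update _ _ _ _
    simp only [hF, hD, hval, hvalk, hham, hloc]
    refine h3.congr_deriv ?_
    ring
  -- The derivative at time `t` is `D` at the rotated configuration, so the supremum `C` of `D` over
  -- the compact configuration space dominates for every `t`.
  have key := (hasDerivAt_integral_of_dominated_loc_of_deriv_le (μ := μ) (x₀ := (0 : ℝ))
    (s := Set.univ) (F := fun t σ => F (T t σ)) (F' := fun t σ => D (T t σ))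
    (bound := fun _ => C) Filter.univ_mem
    (Filter.Eventually.of_forall fun t => (hFc.comp (hTc t)).aestronglyMeasurable)
    (integrable_of_continuous (hFc.comp (hTc 0)))
    (hDc.comp (hTc 0)).aestronglyMeasurable
    (Filter.Eventually.of_forall fun σ t _ => hC (T t σ) trivial)
    (integrable_const C)
    (Filter.Eventually.of_forall fun σ t _ => hderiv t σ)).2
  have hconst (t : ℝ) : ∫ σ, F (T t σ) ∂μ = ∫ σ, F σ ∂μ := by
    have hmp := measurePreserving_update_rotateSphere (V := V) i (rotationFlow hA t)
    have := integral_map (μ := μ) (hTc t).measurable.aemeasurable (f := F)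
      hFc.aestronglyMeasurable
    rw [← this]
    congr 1
    exact hmp.map_eq
  simp_rw [hconst] at key
  have h0 := key.unique (hasDerivAt_const 0 _)
  have hT0 (σ : V → Sphere N) : T 0 σ = σ := by
    have : rotateSphere (rotationFlow hA 0) (σ i) = σ i :=
      Subtype.ext (rotationFlow_zero hA _)
    simp [hT, this]
  simpa only [hT0] using h0

end Model

/-! ### The Gibbs measure: concentration and the Schwinger–Dyson equation. -/

section Gibbs

variable {V : Type*} {N : ℕ}

lemma nonempty_sphere (hN : 1 ≤ N) : Nonempty (Sphere N) :=
  ⟨⟨EuclideanSpace.single ⟨0, hN⟩ 1, by simp⟩⟩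

lemma norm_spin (σ : V → Sphere N) (i : V) :
    ‖(σ i : EuclideanSpace ℝ (Fin N))‖ = 1 := by simp

lemma inner_spin_self (σ : V → Sphere N) (i : V) :
    inner ℝ (σ i : EuclideanSpace ℝ (Fin N)) (σ i) = 1 := by
  rw [real_inner_self_eq_norm_sq, norm_spin, one_pow]

/-- The disagreement `1 - σ_i · σ_j` of two spins. -/
noncomputable def disagreement (i j : V) (σ : V → Sphere N) : ℝ :=
  1 - inner ℝ (σ i : EuclideanSpace ℝ (Fin N)) (σ j)

lemma norm_sub_sq_eq_disagreement (i j : V) (σ : V → Sphere N) :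
    ‖(σ i : EuclideanSpace ℝ (Fin N)) - σ j‖ ^ 2 = 2 * disagreement i j σ := by
  rw [norm_sub_sq_real, norm_spin, norm_spin, disagreement]
  ring

lemma disagreement_self (i : V) (σ : V → Sphere N) : disagreement i i σ = 0 := by
  rw [disagreement, inner_spin_self, sub_self]

lemma disagreement_comm (i j : V) :
    (disagreement i j : (V → Sphere N) → ℝ) = disagreement j i := by
  funext σ
  rw [disagreement, disagreement, real_inner_comm]

lemma disagreement_nonneg (i j : V) (σ : V → Sphere N) : 0 ≤ disagreement i j σ := by
  have := norm_sub_sq_eq_disagreement i j σ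
  nlinarith [sq_nonneg ‖(σ i : EuclideanSpace ℝ (Fin N)) - σ j‖]

lemma disagreement_le_two (i j : V) (σ : V → Sphere N) : disagreement i j σ ≤ 2 := by
  have h := abs_real_inner_le_norm (σ i : EuclideanSpace ℝ (Fin N)) (σ j)
  rw [norm_spin, norm_spin, one_mul] at h
  rw [disagreement]
  linarith [(abs_le.1 h).1]

lemma eq_of_disagreement_eq_zero {i j : V} {σ : V → Sphere N} (h : disagreement i j σ = 0) :
    σ i = σ j := by
  have h2 := norm_sub_sq_eq_disagreement i j σ
  rw [h, mul_zero, sq_eq_zero_iff, norm_sub_eq_zero_iff] at h2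
  exact Subtype.ext h2

lemma continuous_disagreement (i j : V) :
    Continuous (disagreement i j : (V → Sphere N) → ℝ) :=
  continuous_const.sub ((continuous_coe_apply i).inner (continuous_coe_apply j))

variable [Fintype V]

instance : (Measure.pi fun _ : V => sphereMeasure N).IsOpenPosMeasure :=
  Measure.pi.isOpenPosMeasure _

/-- Normalises the energy so that aligned configurations have energy zero. -/
lemma hamiltonian_add_card (G : SimpleGraph V) [DecidableRel G.Adj] (σ : V → Sphere N) :
    hamiltonian G N σ + G.edgeFinset.card = ∑ e ∈ G.edgeFinset,
      Sym2.lift ⟨fun i j => disagreement i j σ,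
        fun i j => congrFun (disagreement_comm i j) σ⟩ e := by
  rw [hamiltonian, Finset.card_eq_sum_ones, Nat.cast_sum, neg_add_eq_sub,
    ← Finset.sum_sub_distrib]
  refine Finset.sum_congr rfl fun e _ => ?_
  induction e with
  | h i j => simp [disagreement]

lemma hamiltonian_add_card_nonneg (G : SimpleGraph V) [DecidableRel G.Adj]
    (σ : V → Sphere N) : 0 ≤ hamiltonian G N σ + G.edgeFinset.card := by
  rw [hamiltonian_add_card]
  refine Finset.sum_nonneg fun e _ => ?_
  induction e with
  | h i j => exact disagreement_nonneg i j σ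

lemma eq_of_hamiltonian_add_card_eq_zero (G : SimpleGraph V) [DecidableRel G.Adj]
    (hG : G.Connected) {σ : V → Sphere N} (h : hamiltonian G N σ + G.edgeFinset.card = 0)
    (i k : V) : σ i = σ k := by
  rw [hamiltonian_add_card, Finset.sum_eq_zero_iff_of_nonneg] at h
  · have hr := (SimpleGraph.reachable_iff_reflTransGen i k).1 (hG.preconnected i k)
    induction hr with
    | refl => rfl
    | @tail v w _ hvw ih =>
      exact ih.trans (eq_of_disagreement_eq_zero (h s(v, w) (by simpa using hvw)))
  · intro e _
    induction e with
    | h i j => exact disagreement_nonneg i j σ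

lemma continuous_boltzmann (G : SimpleGraph V) [DecidableRel G.Adj] (β : ℝ) :
    Continuous fun σ : V → Sphere N => Real.exp (-β * hamiltonian G N σ) :=
  Real.continuous_exp.comp (continuous_const.mul (continuous_hamiltonian G))

lemma partitionFunction_pos (G : SimpleGraph V) [DecidableRel G.Adj] (hN : 1 ≤ N) (β : ℝ) :
    0 < partitionFunction G N β := by
  have := nonempty_sphere hN
  refine integral_pos_of_integrable_nonneg_nonzero (x := fun _ => Classical.arbitrary _)
    (continuous_boltzmann G β) (integrable_of_continuous (continuous_boltzmann G β))
    (fun σ => (Real.exp_pos _).le) (Real.exp_pos _).ne'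

lemma integral_spinMeasure (G : SimpleGraph V) [DecidableRel G.Adj] (hN : 1 ≤ N) (β : ℝ)
    (f : (V → Sphere N) → ℝ) :
    ∫ σ, f σ ∂(spinMeasure G N β) =
      (∫ σ, f σ * Real.exp (-β * hamiltonian G N σ) ∂(Measure.pi fun _ : V => sphereMeasure N)) /
        partitionFunction G N β := by
  have hm : Measurable fun σ : V → Sphere N =>
      ENNReal.ofReal (Real.exp (-β * hamiltonian G N σ) / partitionFunction G N β) :=
    ((continuous_boltzmann G β).div_const _).measurable.ennreal_ofReal
  rw [spinMeasure, integral_withDensity_eq_integral_toReal_smul hm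
    (Filter.Eventually.of_forall fun _ => ENNReal.ofReal_lt_top), ← integral_div]
  refine integral_congr_ae (Filter.Eventually.of_forall fun σ => ?_)
  simp only [smul_eq_mul]
  rw [ENNReal.toReal_ofReal (div_nonneg (Real.exp_pos _).le (partitionFunction_pos G hN β).le)]
  ring

lemma isProbabilityMeasure_spinMeasure (G : SimpleGraph V) [DecidableRel G.Adj] (hN : 1 ≤ N)
    (β : ℝ) : IsProbabilityMeasure (spinMeasure G N β) := by
  have hZ := partitionFunction_pos G hN β
  refine ⟨?_⟩
  rw [spinMeasure, withDensity_apply _ MeasurableSet.univ, Measure.restrict_univ,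
    ← ofReal_integral_eq_lintegral_ofReal
      (integrable_of_continuous ((continuous_boltzmann G β).div_const _))
      (Filter.Eventually.of_forall fun σ => div_nonneg (Real.exp_pos _).le hZ.le),
    integral_div]
  change ENNReal.ofReal (partitionFunction G N β / _) = 1
  rw [div_self hZ.ne', ENNReal.ofReal_one]

lemma integrable_spinMeasure (G : SimpleGraph V) [DecidableRel G.Adj] (hN : 1 ≤ N) (β : ℝ)
    {f : (V → Sphere N) → ℝ} (hf : Continuous f) : Integrable f (spinMeasure G N β) := by
  have := isProbabilityMeasure_spinMeasure (V := V) G hN β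
  rw [← integrableOn_univ]
  exact hf.continuousOn.integrableOn_compact isCompact_univ

/-- The Gibbs measure concentrates on ground states: expectations of functions vanishing at low
energy decay faster than `β⁻¹`. -/
lemma tendsto_mul_integral_zero_of_energy_gap (G : SimpleGraph V) [DecidableRel G.Adj]
    (hN : 1 ≤ N) {h : (V → Sphere N) → ℝ} (hh : Continuous h) {δ : ℝ} (hδ : 0 < δ)
    (hgap : ∀ σ, h σ ≠ 0 → δ ≤ hamiltonian G N σ + G.edgeFinset.card) :
    Tendsto (fun β : ℝ => β * ∫ σ, h σ ∂(spinMeasure G N β)) atTop (𝓝 0) := by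
  have := nonempty_sphere hN
  set μ := Measure.pi fun _ : V => sphereMeasure N with hμ
  set m : ℝ := (G.edgeFinset.card : ℝ)
  obtain ⟨C, hC⟩ := isCompact_univ.exists_bound_of_continuousOn hh.continuousOn
  have hC0 : 0 ≤ C := (norm_nonneg _).trans (hC (fun _ => Classical.arbitrary _) trivial)
  -- Half the gap: `U` bounds the partition function below at energy `δ / 2`, while the numerator
  -- lives at energy at least `δ`. The ratio is of order `exp(-βδ/2)`, which beats the factor `β`.
  set U : Set (V → Sphere N) := {σ | hamiltonian G N σ + m < δ / 2} with hU
  have hUo : IsOpen U := isOpen_lt ((continuous_hamiltonian G).add continuous_const)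
    continuous_const
  have hUne : U.Nonempty := by
    refine ⟨fun _ => Classical.arbitrary _, ?_⟩
    have h0 : hamiltonian G N (fun _ : V => (Classical.arbitrary (Sphere N))) + m = 0 := by
      rw [hamiltonian_add_card]
      refine Finset.sum_eq_zero fun e _ => ?_
      induction e with
      | h i j => exact disagreement_self i fun _ : V => Classical.arbitrary (Sphere N)
    simp only [hU, Set.mem_ofPred_eq, h0]
    positivity
  have hUpos : 0 < μ.real U :=
    ENNReal.toReal_pos (hUo.measure_ne_zero μ hUne) (measure_ne_top μ U)
  have hZ (β : ℝ) (hβ : 0 ≤ β) :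
      Real.exp (-β * (δ / 2 - m)) * μ.real U ≤ partitionFunction G N β := by
    have hint := integrable_of_continuous (continuous_boltzmann (N := N) G β)
    calc Real.exp (-β * (δ / 2 - m)) * μ.real U
        = ∫ _ in U, Real.exp (-β * (δ / 2 - m)) ∂μ := by
          rw [setIntegral_const, smul_eq_mul, mul_comm]
      _ ≤ ∫ σ in U, Real.exp (-β * hamiltonian G N σ) ∂μ := by
          refine setIntegral_mono_on (integrable_const _).integrableOn hint.integrableOn
            hUo.measurableSet fun σ hσ => Real.exp_le_exp.2 ?_
          have hσ' : hamiltonian G N σ + m < δ / 2 := hσ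
          nlinarith
      _ ≤ partitionFunction G N β :=
          setIntegral_le_integral hint (Filter.Eventually.of_forall fun _ => (Real.exp_pos _).le)
  have hnum (β : ℝ) (hβ : 0 ≤ β) :
      |∫ σ, h σ * Real.exp (-β * hamiltonian G N σ) ∂μ| ≤
        C * Real.exp (-β * (δ - m)) * μ.real Set.univ := by
    rw [← Real.norm_eq_abs]
    refine norm_integral_le_of_norm_le_const (Filter.Eventually.of_forall fun σ => ?_)
    by_cases h0 : h σ = 0
    · rw [h0, zero_mul, norm_zero]
      positivity
    · rw [norm_mul, Real.norm_of_nonneg (Real.exp_pos _).le]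
      refine mul_le_mul (hC σ trivial) (Real.exp_le_exp.2 ?_) (Real.exp_pos _).le hC0
      nlinarith [hgap σ h0]
  set K := C * μ.real Set.univ / μ.real U with hK
  have hbound (β : ℝ) (hβ : 0 ≤ β) :
      |β * ∫ σ, h σ ∂(spinMeasure G N β)| ≤ K * (β * Real.exp (-(δ / 2) * β)) := by
    rw [abs_mul, abs_of_nonneg hβ, integral_spinMeasure G hN, abs_div,
      abs_of_pos (partitionFunction_pos G hN β)]
    have hexp : Real.exp (-β * (δ - m)) =
        Real.exp (-(δ / 2) * β) * Real.exp (-β * (δ / 2 - m)) := by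
      rw [← Real.exp_add]; ring_nf
    have hq : |∫ σ, h σ * Real.exp (-β * hamiltonian G N σ) ∂μ| / partitionFunction G N β ≤
        K * Real.exp (-(δ / 2) * β) := by
      rw [div_le_iff₀ (partitionFunction_pos G hN β)]
      calc _ ≤ C * Real.exp (-β * (δ - m)) * μ.real Set.univ := hnum β hβ
        _ = K * Real.exp (-(δ / 2) * β) * (Real.exp (-β * (δ / 2 - m)) * μ.real U) := by
          rw [hexp, hK]; field_simp
        _ ≤ _ := by
          refine mul_le_mul_of_nonneg_left (hZ β hβ) ?_
          positivity
    calc _ ≤ β * (K * Real.exp (-(δ / 2) * β)) := mul_le_mul_of_nonneg_left hq hβ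
      _ = _ := by ring
  have hlim : Tendsto (fun β : ℝ => K * (β * Real.exp (-(δ / 2) * β))) atTop (𝓝 0) := by
    have := tendsto_rpow_mul_exp_neg_mul_atTop_nhds_zero 1 (δ / 2) (by positivity)
    simpa using this.const_mul K
  refine squeeze_zero_norm' ?_ hlim
  filter_upwards [eventually_ge_atTop 0] with β hβ
  exact hbound β hβ

lemma exists_energy_gap (G : SimpleGraph V) [DecidableRel G.Adj] (hG : G.Connected)
    (i k : V) {ε : ℝ} (hε : 0 < ε) :
    ∃ δ > 0, ∀ σ : V → Sphere N, ε ≤ disagreement i k σ →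
      δ ≤ hamiltonian G N σ + G.edgeFinset.card := by
  have hcl : IsCompact {σ : V → Sphere N | ε ≤ disagreement i k σ} :=
    (isClosed_le continuous_const (continuous_disagreement i k)).isCompact
  rcases Set.eq_empty_or_nonempty {σ : V → Sphere N | ε ≤ disagreement i k σ} with he | hne
  · refine ⟨1, one_pos, fun σ hσ => ?_⟩
    have : σ ∈ {σ : V → Sphere N | ε ≤ disagreement i k σ} := hσ
    simp [he] at this
  · obtain ⟨τ, hτ, hmin⟩ := hcl.exists_isMinOn hne
      ((continuous_hamiltonian G).add (continuous_const (y := (G.edgeFinset.card : ℝ)))).continuousOn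
    refine ⟨_, lt_of_le_of_ne (hamiltonian_add_card_nonneg G τ) fun h0 => ?_, fun σ hσ => hmin hσ⟩
    have heq := eq_of_hamiltonian_add_card_eq_zero G hG h0.symm i k
    have hτ' : ε ≤ disagreement i k τ := hτ
    rw [disagreement, ← heq, inner_spin_self, sub_self] at hτ'
    linarith

/-- The positive part is a continuous substitute for the indicator of disagreement above `ε`. -/
lemma tendsto_mul_integral_excess_disagreement (G : SimpleGraph V) [DecidableRel G.Adj]
    (hG : G.Connected) (hN : 1 ≤ N) (i k : V) {ε : ℝ} (hε : 0 < ε) :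
    Tendsto (fun β : ℝ => β * ∫ σ, max (disagreement i k σ - ε) 0 ∂(spinMeasure G N β))
      atTop (𝓝 0) := by
  obtain ⟨δ, hδ, hgap⟩ := exists_energy_gap (N := N) G hG i k hε
  refine tendsto_mul_integral_zero_of_energy_gap G hN
    (((continuous_disagreement i k).sub continuous_const).max continuous_const) hδ
    fun σ hσ => hgap σ ?_
  by_contra hlt
  exact hσ (max_eq_right (by linarith))

variable [DecidableEq V]

/-- Schwinger–Dyson equation for the two-point function. -/
lemma schwinger_dyson (G : SimpleGraph V) [DecidableRel G.Adj] (hN : 1 ≤ N) (β : ℝ)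
    {i k : V} (hik : i ≠ k) :
    ((N : ℝ) - 1) * ∫ σ, inner ℝ (σ i : EuclideanSpace ℝ (Fin N)) (σ k) ∂(spinMeasure G N β) =
      β * ∫ σ, (inner ℝ (σ k : EuclideanSpace ℝ (Fin N)) (localField G i σ) -
        inner ℝ (σ i : EuclideanSpace ℝ (Fin N)) (σ k) *
          inner ℝ (σ i : EuclideanSpace ℝ (Fin N)) (localField G i σ)) ∂(spinMeasure G N β) := by
  set μ := Measure.pi fun _ : V => sphereMeasure N
  have hi := continuous_coe_apply (N := N) i
  have hk := continuous_coe_apply (N := N) k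
  have hW := continuous_localField (N := N) G i
  have hexp := continuous_boltzmann (N := N) G β
  have hsum : ∑ a, ∑ b, ∫ σ : V → Sphere N,
      (inner ℝ (planeRotation a b (planeRotation a b (σ i))) (σ k : EuclideanSpace ℝ (Fin N)) +
        β * (inner ℝ (planeRotation a b (σ i)) (σ k : EuclideanSpace ℝ (Fin N)) *
          inner ℝ (planeRotation a b (σ i)) (localField G i σ))) *
        Real.exp (-β * hamiltonian G N σ) ∂μ = 0 :=
    Finset.sum_eq_zero fun a _ => Finset.sum_eq_zero fun b _ =>
      integral_skewAdjoint_eq_zero G β (planeRotation_mem_skewAdjoint a b) hik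
  have hcont (a b : Fin N) : Continuous fun σ : V → Sphere N =>
      (inner ℝ (planeRotation a b (planeRotation a b (σ i))) (σ k : EuclideanSpace ℝ (Fin N)) +
        β * (inner ℝ (planeRotation a b (σ i)) (σ k : EuclideanSpace ℝ (Fin N)) *
          inner ℝ (planeRotation a b (σ i)) (localField G i σ))) *
        Real.exp (-β * hamiltonian G N σ) := by
    have hA := (planeRotation a b).continuous.comp hi
    have hAA := (planeRotation a b).continuous.comp hA
    exact ((hAA.inner hk).add (continuous_const.mul ((hA.inner hk).mul (hA.inner hW)))).mul hexp
  have hpoint (σ : V → Sphere N) : ∑ a, ∑ b,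
      (inner ℝ (planeRotation a b (planeRotation a b (σ i))) (σ k : EuclideanSpace ℝ (Fin N)) +
        β * (inner ℝ (planeRotation a b (σ i)) (σ k : EuclideanSpace ℝ (Fin N)) *
          inner ℝ (planeRotation a b (σ i)) (localField G i σ))) *
        Real.exp (-β * hamiltonian G N σ) =
      2 * (β * ((inner ℝ (σ k : EuclideanSpace ℝ (Fin N)) (localField G i σ) -
        inner ℝ (σ i : EuclideanSpace ℝ (Fin N)) (σ k) *
          inner ℝ (σ i : EuclideanSpace ℝ (Fin N)) (localField G i σ)) *
            Real.exp (-β * hamiltonian G N σ))) -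
      2 * (((N : ℝ) - 1) * (inner ℝ (σ i : EuclideanSpace ℝ (Fin N)) (σ k) *
        Real.exp (-β * hamiltonian G N σ))) := by
    -- Lagrange's identity handles the products and the Casimir sum the second-order terms;
    -- skew-adjointness gives the latter their minus sign.
    simp_rw [← Finset.sum_mul, Finset.sum_add_distrib, ← Finset.mul_sum]
    rw [sum_inner_planeRotation_mul, inner_spin_self]
    simp_rw [inner_planeRotation_comm _ _ (planeRotation _ _ _), Finset.sum_neg_distrib]
    rw [sum_inner_planeRotation_planeRotation]
    ring
  have hinter := integral_finsetSum (μ := μ) Finset.univ fun a _ =>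
    integrable_finsetSum Finset.univ fun b _ => integrable_of_continuous (hcont a b)
  rw [Finset.sum_congr rfl fun a _ => integral_finsetSum (μ := μ) Finset.univ fun b _ =>
    integrable_of_continuous (hcont a b), hsum] at hinter
  replace hsum := hinter
  simp_rw [hpoint] at hsum
  rw [integral_sub, integral_const_mul, integral_const_mul, integral_const_mul,
    integral_const_mul, sub_eq_zero] at hsum
  · rw [integral_spinMeasure G hN, integral_spinMeasure G hN, ← mul_div_assoc, ← mul_div_assoc]
    congr 1
    linarith
  · exact integrable_of_continuous (continuous_const.mul (continuous_const.mul
      (((hk.inner hW).sub ((hi.inner hk).mul (hi.inner hW))).mul hexp)))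
  · exact integrable_of_continuous (continuous_const.mul (continuous_const.mul
      ((hi.inner hk).mul hexp)))

end Gibbs

/-! ### Green's identity and effective resistance. -/

section Resistance

variable {V : Type*} [Fintype V]

lemma sum_laplacian_mul_comm (G : SimpleGraph V) [DecidableRel G.Adj] (f g : V → ℝ) :
    ∑ i, (∑ j ∈ G.neighborFinset i, (f i - f j)) * g i =
      ∑ i, f i * ∑ j ∈ G.neighborFinset i, (g i - g j) := by
  have hswap : ∑ i, ∑ j ∈ G.neighborFinset i, f j * g i =
      ∑ i, ∑ j ∈ G.neighborFinset i, f i * g j := by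
    refine Finset.sum_comm' fun v w => ?_
    simp [SimpleGraph.adj_comm]
  simp_rw [Finset.sum_mul, Finset.mul_sum, sub_mul, mul_sub, Finset.sum_sub_distrib, hswap]

variable [DecidableEq V] [MeasurableSpace V] [DiscreteMeasurableSpace V]

/-- An approximate solution `g` of the Schwinger–Dyson equations is, up to the error term, a
multiple of the effective resistance. -/
lemma two_mul_eq_voltage_add_error (G : SimpleGraph V) [DecidableRel G.Adj] (hG : G.Connected)
    (c : ℝ) (g e : V → V → ℝ) (hsymm : ∀ i j, g i j = g j i) (hdiag : ∀ i, g i i = 0)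
    (hsd : ∀ i k, ∑ j ∈ G.neighborFinset i, (g i j + g i k - g j k) =
      c * (if i = k then 0 else 1) + e i k)
    {x y : V} (hxy : x ≠ y) :
    2 * g x y = c * voltage G x y x + ∑ i, voltage G x y i * (e i y - e i x) := by
  -- Taking the difference of the equations for `k = y` and `k = x` cancels `g i j` and leaves a
  -- Laplacian.
  have hlap (i : V) : ∑ j ∈ G.neighborFinset i, ((g i y - g i x) - (g j y - g j x)) =
      c * ((if i = x then 1 else 0) - (if i = y then 1 else 0)) + (e i y - e i x) := by
    have h : ∑ j ∈ G.neighborFinset i, ((g i y - g i x) - (g j y - g j x)) =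
        ∑ j ∈ G.neighborFinset i, (g i j + g i y - g j y) -
          ∑ j ∈ G.neighborFinset i, (g i j + g i x - g j x) := by
      rw [← Finset.sum_sub_distrib]
      exact Finset.sum_congr rfl fun j _ => by ring
    rw [h, hsd, hsd]
    split_ifs <;> ring
  have h := sum_laplacian_mul_comm G (voltage G x y) fun i => g i y - g i x
  simp_rw [laplacian_voltage G hG hxy, hlap, mul_add, Finset.sum_add_distrib, sub_mul, mul_sub,
    Finset.sum_sub_distrib] at h
  simp only [ite_mul, one_mul, zero_mul, mul_ite, mul_one, mul_zero, Finset.sum_ite_eq',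
    Finset.mem_univ, if_true, hdiag, voltage_self_right] at h
  rw [hsymm y x] at h
  simp_rw [mul_sub, Finset.sum_sub_distrib]
  linarith

end Resistance

/-! ### Error control and the low-temperature limit. -/

section Limit

variable {V : Type*} [Fintype V] {N : ℕ}

/-- The rescaled two-point function `β 𝔼[1 - σ_i · σ_k]`. -/
noncomputable def scaledDisagreement (G : SimpleGraph V) [DecidableRel G.Adj] (N : ℕ) (β : ℝ)
    (i k : V) : ℝ :=
  β * ∫ σ, disagreement i k σ ∂(spinMeasure G N β)

/-- The error term in the linearised Schwinger–Dyson equation. -/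
noncomputable def sdError (G : SimpleGraph V) [DecidableRel G.Adj] (N : ℕ) (β : ℝ)
    (i k : V) : ℝ :=
  β * ∑ j ∈ G.neighborFinset i, ∫ σ, disagreement i j σ * disagreement i k σ ∂(spinMeasure G N β) -
    ((N : ℝ) - 1) * ∫ σ, disagreement i k σ ∂(spinMeasure G N β)

lemma scaledDisagreement_self (G : SimpleGraph V) [DecidableRel G.Adj] (β : ℝ) (i : V) :
    scaledDisagreement G N β i i = 0 := by
  simp [scaledDisagreement, disagreement_self]

lemma scaledDisagreement_comm (G : SimpleGraph V) [DecidableRel G.Adj] (β : ℝ) (i k : V) :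
    scaledDisagreement G N β i k = scaledDisagreement G N β k i := by
  rw [scaledDisagreement, disagreement_comm, scaledDisagreement]

lemma scaledDisagreement_nonneg (G : SimpleGraph V) [DecidableRel G.Adj] {β : ℝ} (hβ : 0 ≤ β)
    (i k : V) : 0 ≤ scaledDisagreement G N β i k :=
  mul_nonneg hβ (integral_nonneg fun σ => disagreement_nonneg i k σ)

variable [DecidableEq V]

/-- Substitute `σ_i · σ_j = 1 - d_ij` in the Schwinger–Dyson equation: the constants cancel on the
right, and the quadratic term goes into the error. -/
lemma sum_scaledDisagreement (G : SimpleGraph V) [DecidableRel G.Adj] (hN : 1 ≤ N) (β : ℝ)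
    (i k : V) :
    ∑ j ∈ G.neighborFinset i, (scaledDisagreement G N β i j + scaledDisagreement G N β i k -
      scaledDisagreement G N β j k) =
      ((N : ℝ) - 1) * (if i = k then 0 else 1) + sdError G N β i k := by
  have := isProbabilityMeasure_spinMeasure (V := V) G hN β
  have hint (i j : V) : Integrable (disagreement i j) (spinMeasure G N β) :=
    integrable_spinMeasure G hN β (continuous_disagreement i j)
  by_cases hik : i = k
  · subst hik
    simp only [sdError, disagreement_self, mul_zero, integral_zero, Finset.sum_const_zero,
      sub_zero, if_true, add_zero, scaledDisagreement_self]
    exact Finset.sum_eq_zero fun j _ => by rw [scaledDisagreement_comm G β j i, sub_self]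
  · have hsd := schwinger_dyson G hN β hik
    have hL : ∫ σ, inner ℝ (σ i : EuclideanSpace ℝ (Fin N)) (σ k) ∂(spinMeasure G N β) =
        1 - ∫ σ, disagreement i k σ ∂(spinMeasure G N β) := by
      have : ∀ σ : V → Sphere N, inner ℝ (σ i : EuclideanSpace ℝ (Fin N)) (σ k) =
          1 - disagreement i k σ := fun σ => by rw [disagreement]; ring
      simp_rw [this]
      rw [integral_sub (integrable_const _) (hint i k)]
      simp
    have hR : ∀ σ : V → Sphere N, inner ℝ (σ k : EuclideanSpace ℝ (Fin N)) (localField G i σ) -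
        inner ℝ (σ i : EuclideanSpace ℝ (Fin N)) (σ k) *
          inner ℝ (σ i : EuclideanSpace ℝ (Fin N)) (localField G i σ) =
        ∑ j ∈ G.neighborFinset i, ((disagreement i j σ + disagreement i k σ -
          disagreement j k σ) - disagreement i j σ * disagreement i k σ) := by
      intro σ
      rw [localField, inner_sum, inner_sum, Finset.mul_sum, ← Finset.sum_sub_distrib]
      refine Finset.sum_congr rfl fun j _ => ?_
      rw [disagreement, disagreement, disagreement,
        real_inner_comm (σ k : EuclideanSpace ℝ (Fin N)) (σ j)]
      ring
    have hmul (i j k : V) : Integrable (fun σ => disagreement i j σ * disagreement i k σ)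
        (spinMeasure G N β) :=
      integrable_spinMeasure G hN β
        ((continuous_disagreement i j).mul (continuous_disagreement i k))
    simp_rw [hL, hR] at hsd
    have hlin (j : V) : Integrable (fun σ => disagreement i j σ + disagreement i k σ -
        disagreement j k σ) (spinMeasure G N β) := ((hint i j).add (hint i k)).sub (hint j k)
    have hterm (j : V) : ∫ σ, (disagreement i j σ + disagreement i k σ - disagreement j k σ -
        disagreement i j σ * disagreement i k σ) ∂(spinMeasure G N β) =
        ∫ σ, disagreement i j σ ∂(spinMeasure G N β) +
          ∫ σ, disagreement i k σ ∂(spinMeasure G N β) -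
          ∫ σ, disagreement j k σ ∂(spinMeasure G N β) -
          ∫ σ, disagreement i j σ * disagreement i k σ ∂(spinMeasure G N β) := by
      rw [integral_sub (hlin j) (hmul i j k),
        integral_sub (f := fun σ => disagreement i j σ + disagreement i k σ)
          ((hint i j).add (hint i k)) (hint j k),
        integral_add (hint i j) (hint i k)]
    rw [integral_finsetSum _ fun j _ => (hlin j).sub' (hmul i j k)] at hsd
    simp_rw [hterm] at hsd
    rw [Finset.sum_sub_distrib, mul_sub] at hsd
    rw [if_neg hik, mul_one, sdError]
    simp_rw [scaledDisagreement, ← mul_add, ← mul_sub, ← Finset.mul_sum]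
    linarith

omit [DecidableEq V] in
lemma abs_sdError_le (G : SimpleGraph V) [DecidableRel G.Adj] (hN : 1 ≤ N) {β : ℝ} (hβ : 0 < β)
    {ε : ℝ} (hε : 0 < ε) (i k : V) :
    |sdError G N β i k| ≤ (ε + ((N : ℝ) - 1) / β) * ∑ a, ∑ b, scaledDisagreement G N β a b +
      2 * Fintype.card V *
        (β * ∫ σ, max (disagreement i k σ - ε) 0 ∂(spinMeasure G N β)) := by
  have := isProbabilityMeasure_spinMeasure (V := V) G hN β
  set D := ∫ σ, max (disagreement i k σ - ε) 0 ∂(spinMeasure G N β) with hD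
  set S := ∑ a, ∑ b, scaledDisagreement G N β a b with hS
  have hD0 : 0 ≤ D := integral_nonneg fun σ => le_max_right _ _
  have hN' : (0 : ℝ) ≤ (N : ℝ) - 1 := by
    have : (1 : ℝ) ≤ N := by exact_mod_cast hN
    linarith
  have hrow : ∑ j, scaledDisagreement G N β i j ≤ S :=
    Finset.single_le_sum (f := fun a => ∑ b, scaledDisagreement G N β a b)
      (fun a _ => Finset.sum_nonneg fun b _ => scaledDisagreement_nonneg G hβ.le a b)
      (Finset.mem_univ i)
  have hentry : scaledDisagreement G N β i k ≤ S :=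
    (Finset.single_le_sum (f := fun b => scaledDisagreement G N β i b)
      (fun b _ => scaledDisagreement_nonneg G hβ.le i b) (Finset.mem_univ k)).trans hrow
  -- Bound `d_ik` by `ε` plus its excess over `ε`, and use `d_ij ≤ 2` on the excess.
  have hprod (j : V) : ∫ σ, disagreement i j σ * disagreement i k σ ∂(spinMeasure G N β) ≤
      ε * ∫ σ, disagreement i j σ ∂(spinMeasure G N β) + 2 * D := by
    have hc := continuous_disagreement (N := N) i j
    have hcm : Continuous fun σ : V → Sphere N => max (disagreement i k σ - ε) 0 :=
      ((continuous_disagreement i k).sub continuous_const).max continuous_const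
    have h1 : Integrable (fun σ : V → Sphere N => ε * disagreement i j σ) (spinMeasure G N β) :=
      integrable_spinMeasure G hN β (continuous_const.mul hc)
    have h2 : Integrable (fun σ : V → Sphere N => 2 * max (disagreement i k σ - ε) 0)
        (spinMeasure G N β) := integrable_spinMeasure G hN β (continuous_const.mul hcm)
    rw [hD, ← integral_const_mul, ← integral_const_mul, ← integral_add h1 h2]
    refine integral_mono
      (integrable_spinMeasure G hN β (hc.mul (continuous_disagreement i k)))
      (h1.add h2) fun σ => ?_
    have h0 := disagreement_nonneg i j σ
    have h2 := disagreement_le_two i j σ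
    have hm0 := le_max_right (disagreement i k σ - ε) 0
    have hm := le_max_left (disagreement i k σ - ε) 0
    simp only
    nlinarith
  have hsum_nonneg : 0 ≤ β * ∑ j ∈ G.neighborFinset i,
      ∫ σ, disagreement i j σ * disagreement i k σ ∂(spinMeasure G N β) :=
    mul_nonneg hβ.le (Finset.sum_nonneg fun j _ => integral_nonneg fun σ =>
      mul_nonneg (disagreement_nonneg i j σ) (disagreement_nonneg i k σ))
  have hsum : β * ∑ j ∈ G.neighborFinset i,
      ∫ σ, disagreement i j σ * disagreement i k σ ∂(spinMeasure G N β) ≤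
      ε * S + 2 * Fintype.card V * (β * D) := by
    rw [Finset.mul_sum]
    calc _ ≤ ∑ j ∈ G.neighborFinset i, (ε * scaledDisagreement G N β i j + 2 * (β * D)) := by
          refine Finset.sum_le_sum fun j _ => ?_
          refine (mul_le_mul_of_nonneg_left (hprod j) hβ.le).trans (le_of_eq ?_)
          rw [scaledDisagreement]; ring
      _ ≤ ∑ j, (ε * scaledDisagreement G N β i j + 2 * (β * D)) := by
          refine Finset.sum_le_sum_of_subset_of_nonneg (Finset.subset_univ _) fun j _ _ => ?_
          have := scaledDisagreement_nonneg (N := N) G hβ.le i j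
          positivity
      _ = ε * ∑ j, scaledDisagreement G N β i j + 2 * Fintype.card V * (β * D) := by
          rw [Finset.sum_add_distrib, ← Finset.mul_sum, Finset.sum_const, Finset.card_univ,
            nsmul_eq_mul]
          ring
      _ ≤ _ := by gcongr
  have hlast : ((N : ℝ) - 1) * ∫ σ, disagreement i k σ ∂(spinMeasure G N β) ≤
      ((N : ℝ) - 1) / β * S := by
    have h : ∫ σ, disagreement i k σ ∂(spinMeasure G N β) =
        scaledDisagreement G N β i k / β := by
      rw [scaledDisagreement, mul_div_cancel_left₀ _ hβ.ne']
    rw [h, mul_div_assoc', div_mul_eq_mul_div]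
    gcongr
  have hlast_nonneg : 0 ≤ ((N : ℝ) - 1) * ∫ σ, disagreement i k σ ∂(spinMeasure G N β) :=
    mul_nonneg hN' (integral_nonneg fun σ => disagreement_nonneg i k σ)
  have hβD : 0 ≤ 2 * (Fintype.card V : ℝ) * (β * D) := by positivity
  have hS0 : 0 ≤ S := (scaledDisagreement_nonneg G hβ.le i k).trans hentry
  have hNS : 0 ≤ ((N : ℝ) - 1) / β * S := by positivity
  have hεS : 0 ≤ ε * S := by positivity
  rw [sdError, add_mul]
  exact abs_le.2 ⟨by linarith, by linarith⟩

omit [DecidableEq V] in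
lemma eventually_abs_sdError_le (G : SimpleGraph V) [DecidableRel G.Adj] (hG : G.Connected)
    (hN : 1 ≤ N) {ε : ℝ} (hε : 0 < ε) :
    ∀ᶠ β : ℝ in atTop, ∀ i k, |sdError G N β i k| ≤
      ε * (∑ a, ∑ b, scaledDisagreement G N β a b + 1) := by
  have hexcess : ∀ᶠ β : ℝ in atTop, ∀ i k : V, 2 * Fintype.card V *
      (β * ∫ σ, max (disagreement i k σ - ε / 2) 0 ∂(spinMeasure G N β)) ≤ ε := by
    refine eventually_all.2 fun i => eventually_all.2 fun k => ?_
    have h := (tendsto_mul_integral_excess_disagreement (N := N) G hG hN i k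
      (half_pos hε)).const_mul (2 * (Fintype.card V : ℝ))
    rw [mul_zero] at h
    exact h.eventually_le_const hε
  have hdiv : ∀ᶠ β : ℝ in atTop, ((N : ℝ) - 1) / β ≤ ε / 2 :=
    (tendsto_const_nhds.div_atTop tendsto_id).eventually_le_const (half_pos hε)
  -- The cutoff and `(N-1)/β` each contribute `ε / 2` times the sum; the excess contributes the
  -- remaining `ε`.
  filter_upwards [hexcess, hdiv, eventually_gt_atTop 0] with β h1 h2 hβ i k
  have hS : 0 ≤ ∑ a, ∑ b, scaledDisagreement G N β a b :=
    Finset.sum_nonneg fun a _ => Finset.sum_nonneg fun b _ =>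
      scaledDisagreement_nonneg G hβ.le a b
  have h := abs_sdError_le G hN hβ (half_pos hε) i k
  nlinarith [h1 i k]

variable [MeasurableSpace V] [DiscreteMeasurableSpace V]

lemma exists_eventually_abs_sub_voltage_le (G : SimpleGraph V) [DecidableRel G.Adj]
    (hG : G.Connected) (hN : 1 ≤ N) :
    ∃ M : ℝ, 0 ≤ M ∧ ∀ ε > 0, ∀ᶠ β : ℝ in atTop, ∀ x y, x ≠ y →
      |2 * scaledDisagreement G N β x y - ((N : ℝ) - 1) * voltage G x y x| ≤
        M * (ε * (∑ a, ∑ b, scaledDisagreement G N β a b + 1)) := by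
  -- The factor `2` counts the two errors in the difference. The constant depends on neither `ε` nor
  -- `β`, as the bootstrap requires.
  refine ⟨∑ x, ∑ y, ∑ i, |voltage G x y i| * 2, by positivity, fun ε hε => ?_⟩
  filter_upwards [eventually_abs_sdError_le (N := N) G hG hN hε] with β hβ x y hxy
  set B := ε * (∑ a, ∑ b, scaledDisagreement G N β a b + 1)
  have hB : 0 ≤ B := (abs_nonneg _).trans (hβ x y)
  rw [two_mul_eq_voltage_add_error G hG ((N : ℝ) - 1) (scaledDisagreement G N β)
    (sdError G N β) (scaledDisagreement_comm G β) (scaledDisagreement_self G β)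
    (sum_scaledDisagreement G hN β) hxy, add_sub_cancel_left]
  calc _ ≤ ∑ i, |voltage G x y i * (sdError G N β i y - sdError G N β i x)| :=
        Finset.abs_sum_le_sum_abs _ _
    _ ≤ ∑ i, |voltage G x y i| * 2 * B := by
        refine Finset.sum_le_sum fun i _ => ?_
        rw [abs_mul, mul_assoc]
        refine mul_le_mul_of_nonneg_left ?_ (abs_nonneg _)
        have := abs_sub (sdError G N β i y) (sdError G N β i x)
        linarith [hβ i y, hβ i x]
    _ = (∑ i, |voltage G x y i| * 2) * B := by rw [Finset.sum_mul]
    _ ≤ _ := by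
        refine mul_le_mul_of_nonneg_right ?_ hB
        refine (Finset.single_le_sum (f := fun y => ∑ i, |voltage G x y i| * 2)
          (fun y _ => by positivity) (Finset.mem_univ y)).trans ?_
        exact Finset.single_le_sum (f := fun x => ∑ y, ∑ i, |voltage G x y i| * 2)
          (fun x _ => by positivity) (Finset.mem_univ x)

lemma exists_eventually_sum_scaledDisagreement_le (G : SimpleGraph V) [DecidableRel G.Adj]
    (hG : G.Connected) (hN : 1 ≤ N) :
    ∃ C : ℝ, ∀ᶠ β : ℝ in atTop, ∑ a, ∑ b, scaledDisagreement G N β a b ≤ C := by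
  obtain ⟨M, hM, hbound⟩ := exists_eventually_abs_sub_voltage_le (N := N) G hG hN
  set n : ℝ := (Fintype.card V : ℝ)
  set R : ℝ := ∑ a, ∑ b, |((N : ℝ) - 1) * voltage G a b a| with hR
  have hn : 0 ≤ n := Nat.cast_nonneg _
  -- Chosen so that summing over all pairs gives `2S ≤ R + (S + 1)`, which bounds `S` by `R + 1`.
  set ε : ℝ := 1 / (n * n * M + 1)
  have hε : 0 < ε := by positivity
  refine ⟨R + 1, ?_⟩
  filter_upwards [hbound ε hε, eventually_ge_atTop 0] with β hβ hβ0
  set S := ∑ a, ∑ b, scaledDisagreement G N β a b with hS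
  have hS0 : 0 ≤ S := Finset.sum_nonneg fun a _ => Finset.sum_nonneg fun b _ =>
      scaledDisagreement_nonneg G hβ0 a b
  have hentry (a b : V) : 2 * scaledDisagreement G N β a b ≤
      |((N : ℝ) - 1) * voltage G a b a| + M * (ε * (S + 1)) := by
    by_cases hab : a = b
    · subst hab
      rw [scaledDisagreement_self, mul_zero]
      positivity
    · linarith [(abs_le.1 (hβ a b hab)).2, le_abs_self (((N : ℝ) - 1) * voltage G a b a)]
  have hsum : 2 * S ≤ R + n * n * M * ε * (S + 1) := by
    calc 2 * S = ∑ a, ∑ b, 2 * scaledDisagreement G N β a b := by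
          simp_rw [hS, Finset.mul_sum]
      _ ≤ ∑ a, ∑ b, (|((N : ℝ) - 1) * voltage G a b a| + M * (ε * (S + 1))) :=
          Finset.sum_le_sum fun a _ => Finset.sum_le_sum fun b _ => hentry a b
      _ = _ := by
          simp_rw [Finset.sum_add_distrib, Finset.sum_const, Finset.card_univ, nsmul_eq_mul]
          ring
  have hsmall : n * n * M * ε ≤ 1 := by
    rw [mul_one_div, div_le_one (by positivity)]
    linarith
  nlinarith

lemma tendsto_two_mul_scaledDisagreement (G : SimpleGraph V) [DecidableRel G.Adj]
    (hG : G.Connected) (hN : 1 ≤ N) {x y : V} (hxy : x ≠ y) :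
    Tendsto (fun β : ℝ => 2 * scaledDisagreement G N β x y) atTop
      (𝓝 (((N : ℝ) - 1) * voltage G x y x)) := by
  obtain ⟨M, hM, hbound⟩ := exists_eventually_abs_sub_voltage_le (N := N) G hG hN
  obtain ⟨C, hC⟩ := exists_eventually_sum_scaledDisagreement_le (N := N) G hG hN
  rw [Metric.tendsto_nhds]
  intro η hη
  -- The added `1` keeps the denominator positive when `M = 0` and makes the final inequality
  -- strict.
  have hK : 0 < M * (|C| + 1) + 1 := by positivity
  filter_upwards [hbound (η / (M * (|C| + 1) + 1)) (by positivity), hC] with β h1 h2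
  rw [Real.dist_eq]
  refine (h1 x y hxy).trans_lt ?_
  calc _ ≤ M * (η / (M * (|C| + 1) + 1) * (|C| + 1)) := by
        gcongr
        exact h2.trans (le_abs_self C)
    _ = η * (M * (|C| + 1)) / (M * (|C| + 1) + 1) := by ring
    _ < η := by
        rw [div_lt_iff₀ hK]
        nlinarith

end Limit

end SpinON

theorem theorem8 {V : Type*} [Fintype V] [DecidableEq V]
    [MeasurableSpace V] [DiscreteMeasurableSpace V]
    (G : SimpleGraph V) [DecidableRel G.Adj] (hG : G.Connected)
    (N : ℕ) (hN : 1 ≤ N) (x y : V) :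
    SpinON.green G x y x ≠ ∞ ∧
    Tendsto
      (fun β : ℝ => β *
        ∫ σ, ‖(σ x : EuclideanSpace ℝ (Fin N)) - (σ y : EuclideanSpace ℝ (Fin N))‖ ^ 2
          ∂(SpinON.spinMeasure G N β))
      atTop
      (𝓝 (((N : ℝ) - 1) * ((SpinON.green G x y x).toReal / (G.degree x : ℝ)))) := by
  refine ⟨SpinON.green_ne_top G hG x y x, ?_⟩
  by_cases hxy : x = y
  · subst hxy
    simp [SpinON.green_self_right]
  · refine (SpinON.tendsto_two_mul_scaledDisagreement G hG hN hxy).congr fun β => ?_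
    simp_rw [SpinON.norm_sub_sq_eq_disagreement, integral_const_mul]
    rw [SpinON.scaledDisagreement]
    ring
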